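/- Let $R$ be a commutative ring and let $\mathcal R$ be the functor of rings on commutative $R$-algebras given by $\mathcal R(S)=S$. A functor of $\mathcal R$-modules is a covariant functor $\mathbb M$ from commutative $R$-algebras to sets together with morphisms of functors $\mathbb M\times\mathbb M\to\mathbb M$ and $\mathcal R\times\mathbb M\to\mathbb M$ making every $\mathbb M(S)$ an $S$-module; morphisms are morphisms of functors that are $S$-linear for every $S$. For functors of $\mathcal R$-modules $\mathbb M',\mathbb M$, let $\mathbb{H}\mathrm{om}_{\mathcal R}(\mathbb M',\mathbb M)$ be the functor of $\mathcal R$-modules $S\mapsto \mathrm{Hom}_{\mathcal S}(\mathbb M'_{|S},\mathbb M_{|S})$, where $\mathcal S$ is the functor $\mathcal S(T)=T$ on commutative $S$-algebras and ${}_{|S}$ is restriction to commutative $S$-algebras. Put $\mathbb M^*=\mathbb{H}\mathrm{om}_{\mathcal R}(\mathbb M,\mathcal R)$, and call a functor of $\mathcal R$-modules a dual functor if it is isomorphic to $\mathbb N^*$ for some functor of $\mathcal R$-modules $\mathbb N$. For a set $J$, regard $\prod_J\mathcal R$ as a functor of $\mathcal R$-algebras with componentwise product; it acts componentwise on $\oplus_J\mathcal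 R$ and on $\prod_J\mathcal R$. Say that $\mathbb M$ is *sandwiched over $J$* if there exist a structure of functor of $\prod_J\mathcal R$-modules on $\mathbb M$ (inducing the given $\mathcal R$-module structure) and inclusions of functors of $\prod_J\mathcal R$-modules $$\oplus_J\mathcal R\subseteq\mathbb M\subseteq\prod_J\mathcal R$$ whose composite is the obvious inclusion $\oplus_J\mathcal R\subseteq\prod_J\mathcal R$. Let $\mathfrak F$ be the family of dual functors of $\mathcal R$-modules that are sandwiched over some set $J$. **Theorem.** If $\mathbb M'$ and $\mathbb M$ belong to $\mathfrak F$, then $\mathbb{H}\mathrm{om}_{\mathcal R}(\mathbb M',\mathbb M)$ belongs to $\mathfrak F$. More precisely, it is a dual functor, and for all sets $I$ and $J$ such that $\mathbb M'$ is sandwiched over $I$ and $\mathbb M$ is sandwiched over $J$, it is sandwiched over $I\times J$: it has a structure of functor of $\prod_{I\times J}\mathcal R$-modules and inclusions of functors of $\prod_{I\times J}\mathcal R$-modules $\oplus_{I\times J}\mathcal R\subseteq\mathbb{H}\mathrm{om}_{\mathcal R}(\mathbb M',\mathbb M)\subseteq\prod_{I\times J}\mathcal R$ composing to the obvious inclusion.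 -/

import Mathlib

universe u v w

/-- A functor of `𝓡`-modules: a covariant functor `M` from commutative `R`-algebras to sets such that
every `M(S)` is an `S`-module, addition `M × M → M` and scalar multiplication `𝓡 × M → M`
being morphisms of functors (`map_add`, `map_smul`). -/
structure FunctorOfModules (R : Type u) [CommRing R] where
  obj : ∀ (S : Type u) [CommRing S] [Algebra R S], Type w
  [addCommGroup : ∀ (S : Type u) [CommRing S] [Algebra R S], AddCommGroup (obj S)]
  [module : ∀ (S : Type u) [CommRing S] [Algebra R S], Module S (obj S)]
  map : ∀ {S T : Type u} [CommRing S] [Algebra R S] [CommRing T] [Algebra R T],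
    (S →ₐ[R] T) → obj S → obj T
  map_id : ∀ (S : Type u) [CommRing S] [Algebra R S] (m : obj S), map (AlgHom.id R S) m = m
  map_comp : ∀ {S T U : Type u} [CommRing S] [Algebra R S] [CommRing T] [Algebra R T]
    [CommRing U] [Algebra R U] (g : T →ₐ[R] U) (f : S →ₐ[R] T) (m : obj S),
    map (g.comp f) m = map g (map f m)
  map_add : ∀ {S T : Type u} [CommRing S] [Algebra R S] [CommRing T] [Algebra R T]
    (f : S →ₐ[R] T) (m n : obj S), map f (m + n) = map f m + map f n
  map_smul : ∀ {S T : Type u} [CommRing S] [Algebra R S] [CommRing T] [Algebra R T]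
    (f : S →ₐ[R] T) (s : S) (m : obj S), map f (s • m) = f s • map f m

namespace FunctorOfModules

attribute [instance] FunctorOfModules.addCommGroup FunctorOfModules.module

variable {R : Type u} [CommRing R]

/-- A morphism of functors of `𝓡`-modules. -/
structure Hom (M : FunctorOfModules.{u, v} R) (N : FunctorOfModules.{u, w} R) where
  app : ∀ (S : Type u) [CommRing S] [Algebra R S], M.obj S →ₗ[S] N.obj S
  naturality : ∀ {S T : Type u} [CommRing S] [Algebra R S] [CommRing T] [Algebra R T]
    (f : S →ₐ[R] T) (m : M.obj S), app T (M.map f m) = N.map f (app S m)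

/-- `Hom_𝓢(M|S, N|S)`: the morphisms of functors of `𝓢`-modules from `M|S` to `N|S`, the
restrictions of `M` and `N` to commutative `S`-algebras. A commutative `S`-algebra is given as a
commutative `R`-algebra `T` together with its structure morphism `φ : S →ₐ[R] T`, and a morphism of
`S`-algebras from `(T, φ)` to `(U, ψ)` is a `g : T →ₐ[R] U` with `g ∘ φ = ψ`. -/
@[ext]
structure RestrictedHom (M : FunctorOfModules.{u, v} R) (N : FunctorOfModules.{u, w} R)
    (S : Type u) [CommRing S] [Algebra R S] where
  app : ∀ (T : Type u) [CommRing T] [Algebra R T], (S →ₐ[R] T) → (M.obj T →ₗ[T] N.obj T)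
  naturality : ∀ {T U : Type u} [CommRing T] [Algebra R T] [CommRing U] [Algebra R U]
    (φ : S →ₐ[R] T) (g : T →ₐ[R] U) (m : M.obj T),
    app U (g.comp φ) (M.map g m) = N.map g (app T φ m)

theorem map_zero (M : FunctorOfModules.{u, v} R) {S T : Type u} [CommRing S] [Algebra R S]
    [CommRing T] [Algebra R T] (f : S →ₐ[R] T) : M.map f 0 = 0 := by
  simpa using M.map_smul f 0 0

theorem map_neg (M : FunctorOfModules.{u, v} R) {S T : Type u} [CommRing S] [Algebra R S]
    [CommRing T] [Algebra R T] (f : S →ₐ[R] T) (m : M.obj S) : M.map f (-m) = -M.map f m := by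
  simpa using M.map_smul f (-1) m

namespace RestrictedHom

variable {M : FunctorOfModules.{u, v} R} {N : FunctorOfModules.{u, w} R}
  {S : Type u} [CommRing S] [Algebra R S]

instance : Zero (RestrictedHom M N S) where
  zero := { app := fun _ _ _ _ => 0
            naturality := fun _ g _ => by simp [map_zero] }

instance : Add (RestrictedHom M N S) where
  add f g := { app := fun T _ _ φ => f.app T φ + g.app T φ
               naturality := fun φ h m => by simp [N.map_add, f.naturality, g.naturality] }

instance : Neg (RestrictedHom M N S) where
  neg f := { app := fun T _ _ φ => -f.app T φ
             naturality := fun φ h m => by simp [map_neg, f.naturality] }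

/-- An element `s` of `S` acts over the `S`-algebra `(T, φ)` as its image `φ s`. -/
instance : SMul S (RestrictedHom M N S) where
  smul s f := { app := fun T _ _ φ => φ s • f.app T φ
                naturality := fun φ h m => by simp [N.map_smul, f.naturality] }

theorem zero_app (T : Type u) [CommRing T] [Algebra R T] (φ : S →ₐ[R] T) :
    (0 : RestrictedHom M N S).app T φ = 0 := rfl

theorem add_app (f g : RestrictedHom M N S) (T : Type u) [CommRing T] [Algebra R T]
    (φ : S →ₐ[R] T) : (f + g).app T φ = f.app T φ + g.app T φ := rfl

theorem neg_app (f : RestrictedHom M N S) (T : Type u) [CommRing T] [Algebra R T]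
    (φ : S →ₐ[R] T) : (-f).app T φ = -f.app T φ := rfl

theorem smul_app (s : S) (f : RestrictedHom M N S) (T : Type u) [CommRing T] [Algebra R T]
    (φ : S →ₐ[R] T) : (s • f).app T φ = φ s • f.app T φ := rfl

theorem ext' {f g : RestrictedHom M N S}
    (h : ∀ (T : Type u) [CommRing T] [Algebra R T] (φ : S →ₐ[R] T), f.app T φ = g.app T φ) :
    f = g := by
  apply RestrictedHom.ext
  funext T _ _ φ
  exact h T φ

instance : AddCommGroup (RestrictedHom M N S) where
  add_assoc f g h := ext' fun T _ _ φ => by simp only [add_app, add_assoc]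
  zero_add f := ext' fun T _ _ φ => by simp only [add_app, zero_app, zero_add]
  add_zero f := ext' fun T _ _ φ => by simp only [add_app, zero_app, add_zero]
  add_comm f g := ext' fun T _ _ φ => by simp only [add_app, add_comm]
  neg_add_cancel f := ext' fun T _ _ φ => by
    simp only [add_app, neg_app, zero_app, neg_add_cancel]
  nsmul := nsmulRec
  zsmul := zsmulRec

instance : Module S (RestrictedHom M N S) where
  one_smul f := ext' fun T _ _ φ => by simp only [smul_app, map_one, one_smul]
  mul_smul s t f := ext' fun T _ _ φ => by simp only [smul_app, map_mul, mul_smul]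
  smul_zero s := ext' fun T _ _ φ => by simp only [smul_app, zero_app, smul_zero]
  smul_add s f g := ext' fun T _ _ φ => by simp only [smul_app, add_app, smul_add]
  add_smul s t f := ext' fun T _ _ φ => by simp only [smul_app, add_app, _root_.map_add, add_smul]
  zero_smul f := ext' fun T _ _ φ => by
    simp only [smul_app, zero_app, _root_.map_zero, zero_smul]

end RestrictedHom

/-- The functor of `𝓡`-modules `𝐇𝐨𝐦_𝓡(M, N)`, with `𝐇𝐨𝐦_𝓡(M, N)(S) = Hom_𝓢(M|S, N|S)`; along
`f : S → T` a morphism is restricted to the commutative `T`-algebras. -/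
abbrev internalHom (M : FunctorOfModules.{u, v} R) (N : FunctorOfModules.{u, w} R) :
    FunctorOfModules.{u, max (u + 1) v w} R where
  obj S _ _ := RestrictedHom M N S
  map f h := { app := fun U _ _ φ => h.app U (φ.comp f)
               naturality := fun φ g m => h.naturality (φ.comp f) g m }
  map_id _ _ _ _ := rfl
  map_comp _ _ _ := rfl
  map_add _ _ _ := rfl
  map_smul _ _ _ := rfl

variable (R) in
/-- The functor `𝓡`, with `𝓡(S) = S`. -/
abbrev structureFunctor : FunctorOfModules.{u, u} R where
  obj S _ _ := S
  addCommGroup _ _ _ := inferInstance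
  module _ _ _ := inferInstance
  map f s := f s
  map_id _ _ _ _ := rfl
  map_comp _ _ _ := rfl
  map_add f := _root_.map_add f
  map_smul f := map_mul f

/-- The dual `M^* = 𝐇𝐨𝐦_𝓡(M, 𝓡)`. -/
abbrev dual (M : FunctorOfModules.{u, v} R) : FunctorOfModules.{u, max (u + 1) v} R :=
  internalHom M (structureFunctor R)

/-- `M` is a dual functor: it is isomorphic to `N^*` for some functor of `𝓡`-modules `N`. -/
def IsDualFunctor (M : FunctorOfModules.{u, v} R) : Prop :=
  ∃ (N : FunctorOfModules.{u, u} R) (e : Hom M (dual N)),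
    ∀ (S : Type u) [CommRing S] [Algebra R S], Function.Bijective (e.app S)

variable (R) in
/-- `∏_J 𝓡`. -/
abbrev prod (J : Type u) : FunctorOfModules.{u, u} R where
  obj S _ _ := J → S
  addCommGroup _ _ _ := inferInstance
  module _ _ _ := inferInstance
  map f a := fun j => f (a j)
  map_id _ _ _ _ := rfl
  map_comp _ _ _ := rfl
  map_add f a b := by funext j; exact _root_.map_add f (a j) (b j)
  map_smul f s a := by funext j; exact map_mul f s (a j)

variable (R) in
/-- `⊕_J 𝓡`. -/
noncomputable abbrev directSum (J : Type u) : FunctorOfModules.{u, u} R where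
  obj S _ _ := J →₀ S
  addCommGroup _ _ _ := inferInstance
  module _ _ _ := inferInstance
  map f a := a.mapRange f (_root_.map_zero f)
  map_id _ _ _ a := by ext j; simp
  map_comp g f a := by ext j; simp
  map_add f a b := by ext j; simp
  map_smul f s a := by ext j; simp

/-- A structure of functor of `∏_J 𝓡`-modules on the functor of `𝓡`-modules `M`, where `∏_J 𝓡` is
the functor of `𝓡`-algebras `S ↦ (J → S)` with the componentwise product: a `(J → S)`-module
structure on every `M(S)`, functorial in `S`, and inducing the given `S`-module structure through
the diagonal `S → (J → S)`. -/
structure ProdModuleStructure (J : Type u) (M : FunctorOfModules.{u, v} R) where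
  module : ∀ (S : Type u) [CommRing S] [Algebra R S], Module (J → S) (M.obj S)
  map_smul : ∀ {S T : Type u} [CommRing S] [Algebra R S] [CommRing T] [Algebra R T]
    (f : S →ₐ[R] T) (a : J → S) (m : M.obj S),
    letI := module S
    letI := module T
    M.map f (a • m) = (fun j => f (a j)) • M.map f m
  diagonal_smul : ∀ {S : Type u} [CommRing S] [Algebra R S] (s : S) (m : M.obj S),
    letI := module S
    (fun _ : J => s) • m = s • m

/-- A structure of functor of `∏_J 𝓡`-modules on `M` together with inclusions
`⊕_J 𝓡 ⊆ M ⊆ ∏_J 𝓡` of functors of `∏_J 𝓡`-modules whose composite is the obvious inclusion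
`⊕_J 𝓡 ⊆ ∏_J 𝓡`. Both `⊕_J 𝓡` and `∏_J 𝓡` carry the componentwise action of `∏_J 𝓡`. -/
structure Sandwich (J : Type u) (M : FunctorOfModules.{u, v} R) extends
    ProdModuleStructure J M where
  incl : Hom (directSum R J) M
  toProd : Hom M (prod R J)
  incl_injective : ∀ (S : Type u) [CommRing S] [Algebra R S], Function.Injective (incl.app S)
  toProd_injective : ∀ (S : Type u) [CommRing S] [Algebra R S],
    Function.Injective (toProd.app S)
  incl_smul : ∀ (S : Type u) [CommRing S] [Algebra R S] (a : J → S) (b : J →₀ S),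
    letI := module S
    incl.app S (a • b : J →₀ S) = a • incl.app S b
  toProd_smul : ∀ (S : Type u) [CommRing S] [Algebra R S] (a : J → S) (m : M.obj S),
    letI := module S
    toProd.app S (a • m) = fun j => a j * (toProd.app S m : J → S) j
  toProd_incl : ∀ (S : Type u) [CommRing S] [Algebra R S] (b : J →₀ S),
    toProd.app S (incl.app S b) = fun j => b j

/-- The family `𝔉`. -/
def MemF (M : FunctorOfModules.{u, v} R) : Prop :=
  IsDualFunctor M ∧ ∃ J : Type u, Nonempty (Sandwich J M)

end FunctorOfModules

/-! ### Natural functionals on products. -/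

namespace FunctorOfModules

variable {R : Type u} [CommRing R]

/-! Give `f : M' → M` the matrix `f_ij`, the `j`-th coordinate of `f(e_i)`. It determines `f`: for a
functional `w` on `M'` and a point `m`, the map `b ↦ w(b • m)` is a functional on `∏_I 𝓡`, hence a
finite combination of coordinates (its value at the generic point is a polynomial, which has
finitely many variables). At `b = 1` this gives `w(m) = ∑ m_i w(e_i)`, a finite sum. Taking for `w`
the coordinates of `f` embeds the morphisms in `∏_{I×J} 𝓡`, and elementary matrices supply `⊕_{I×J}
𝓡`.

The main point is that matrices of morphisms are stable under entrywise multiplication by an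
arbitrary `a`. The value at `m` of the new morphism should be the possibly infinite sum of `a_ij
x_ij`, where `x_ij = e_j • f(e_i • m)`. Since `M = N^*`, the sum makes sense once its pairing with
each point `n` of `N` is finite. That holds because `(b, c) ↦ ⟨c • f(b • m), n⟩` is natural on `∏_{I
⊔ J} 𝓡`, so it depends on finitely many coordinates, and it vanishes when `b = 0` or `c = 0`. This
is `finite_support_act_act`; `exists_restrictedHom_prod_of_finite_support` then performs the
summation.

Duality is the tensor-hom adjunction: the predual is `M' ⊗ N`. -/

/-- A natural family of maps `(K → T) → T` only depends on finitely many coordinates, since it is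
evaluation of a single polynomial, its value at the generic point. -/
theorem exists_finset_forall_eq_of_natural {S : Type u} [CommRing S] [Algebra R S] {K : Type u}
    (h : ∀ (T : Type u) [CommRing T] [Algebra R T], (S →ₐ[R] T) → (K → T) → T)
    (nat : ∀ {T U : Type u} [CommRing T] [Algebra R T] [CommRing U] [Algebra R U]
      (φ : S →ₐ[R] T) (g : T →ₐ[R] U) (b : K → T),
      h U (g.comp φ) (fun k => g (b k)) = g (h T φ b)) :
    ∃ s : Finset K, ∀ (T : Type u) [CommRing T] [Algebra R T] (φ : S →ₐ[R] T) (b b' : K → T),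
      (∀ k ∈ s, b k = b' k) → h T φ b = h T φ b' := by
  classical
  let ι : S →ₐ[R] MvPolynomial K S := IsScalarTower.toAlgHom R S _
  let p := h (MvPolynomial K S) ι MvPolynomial.X
  have key : ∀ (T : Type u) [CommRing T] [Algebra R T] (φ : S →ₐ[R] T) (b : K → T),
      h T φ b = MvPolynomial.eval₂Hom (φ : S →+* T) b p := by
    intro T _ _ φ b
    let g : MvPolynomial K S →ₐ[R] T :=
      { MvPolynomial.eval₂Hom (φ : S →+* T) b with
        commutes' := fun r => by
          simp [IsScalarTower.algebraMap_apply R S (MvPolynomial K S),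
            MvPolynomial.algebraMap_eq] }
    have hg : ∀ q, g q = MvPolynomial.eval₂Hom (φ : S →+* T) b q := fun _ => rfl
    have h1 : g.comp ι = φ := by
      ext x
      simp [hg, ι, MvPolynomial.algebraMap_eq]
    have h2 := nat ι g MvPolynomial.X
    rw [h1] at h2
    rw [← hg, ← h2]
    congr 1
    funext k
    simp [hg]
  refine ⟨p.vars, fun T _ _ φ b b' hb => ?_⟩
  rw [key, key]
  exact MvPolynomial.eval₂Hom_congr' rfl (fun i hi _ => hb i hi) rfl

/-- A linear functional on `∏_K 𝓡` is a finite linear combination of coordinates. -/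
theorem RestrictedHom.exists_finset_apply_eq_sum {S : Type u} [CommRing S]
    [Algebra R S] {K : Type u} [DecidableEq K]
    (w : RestrictedHom (prod R K) (structureFunctor R) S) :
    ∃ s : Finset K, ∀ (T : Type u) [CommRing T] [Algebra R T] (φ : S →ₐ[R] T),
      (∀ k ∉ s, w.app T φ (Pi.single k 1 : K → T) = (0 : T)) ∧
      ∀ b : K → T, w.app T φ b = (∑ k ∈ s, b k * w.app T φ (Pi.single k 1 : K → T) : T) := by
  obtain ⟨s, hs⟩ := exists_finset_forall_eq_of_natural (S := S) (K := K)
    (fun T _ _ φ b => w.app T φ b) (fun φ g b => w.naturality φ g b)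
  refine ⟨s, fun T _ _ φ => ⟨fun k hk => ?_, fun b => ?_⟩⟩
  · rw [hs T φ (Pi.single k 1) 0 fun l hl => ?_]
    · exact _root_.map_zero (w.app T φ)
    · rw [Pi.single_eq_of_ne (by rintro rfl; exact hk hl)]; rfl
  -- On `s`, `b` agrees with its truncation to `s`, so `w` takes the same value on both.
  · rw [hs T φ b (∑ k ∈ s, b k • (Pi.single k 1 : K → T)) fun l hl => ?_]
    · refine (map_sum (w.app T φ) _ _).trans (Finset.sum_congr rfl fun k _ => ?_)
      exact (w.app T φ).map_smul _ _
    · simp [Finset.sum_apply, Pi.single_apply, hl]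

/-! ### Coordinates and functionals on a sandwiched functor. -/

namespace Sandwich

variable {J : Type u} {M : FunctorOfModules.{u, v} R} (s : Sandwich J M)

section

variable {S : Type u} [CommRing S] [Algebra R S]

/-- The `j`-th coordinate on a sandwiched functor. -/
def coord (S : Type u) [CommRing S] [Algebra R S] (j : J) : M.obj S →ₗ[S] S :=
  (LinearMap.proj j : (J → S) →ₗ[S] S).comp (s.toProd.app S)

theorem ext_coord {m n : M.obj S} (h : ∀ j, s.coord S j m = s.coord S j n) : m = n :=
  s.toProd_injective S (funext h)

theorem coord_map {T : Type u} [CommRing T] [Algebra R T] (f : S →ₐ[R] T) (m : M.obj S) (j : J) :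
    s.coord T j (M.map f m) = f (s.coord S j m) :=
  congrFun (s.toProd.naturality f m) j

/-- The action of `∏_J 𝓡` on a sandwiched functor. -/
def act (a : J → S) (m : M.obj S) : M.obj S :=
  letI := s.module S
  a • m

theorem coord_act (a : J → S) (m : M.obj S) (j : J) :
    s.coord S j (s.act a m) = a j * s.coord S j m :=
  congrFun (s.toProd_smul S a m) j

theorem coord_incl (b : J →₀ S) (j : J) : s.coord S j (s.incl.app S b) = b j :=
  congrFun (s.toProd_incl S b) j

theorem map_act {T : Type u} [CommRing T] [Algebra R T] (f : S →ₐ[R] T) (a : J → S)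
    (m : M.obj S) : M.map f (s.act a m) = s.act (fun j => f (a j)) (M.map f m) :=
  s.ext_coord fun j => by simp only [coord_map, coord_act, map_mul]

/-- The basis element `e_j` of `⊕_J 𝓡`, in a sandwiched functor. -/
noncomputable def basis (S : Type u) [CommRing S] [Algebra R S] (j : J) : M.obj S :=
  s.incl.app S (Finsupp.single j 1)

theorem coord_basis [DecidableEq J] (i j : J) :
    s.coord S j (s.basis S i) = if i = j then 1 else 0 := by
  rw [basis, coord_incl, Finsupp.single_apply]

theorem map_basis {T : Type u} [CommRing T] [Algebra R T] (f : S →ₐ[R] T) (j : J) :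
    M.map f (s.basis S j) = s.basis T j := by
  classical
  exact s.ext_coord fun i => by
    rw [coord_map, coord_basis, coord_basis]; split_ifs <;> simp

/-- The idempotents of `∏_J 𝓡` cut any point down to `⊕_J 𝓡`; this is where the module structure
over the product enters. -/
theorem act_single [DecidableEq J] (j : J) (m : M.obj S) :
    s.act (Pi.single j 1) m = s.coord S j m • s.basis S j :=
  s.ext_coord fun i => by
    rw [coord_act, _root_.map_smul, coord_basis, smul_eq_mul]
    by_cases h : j = i
    · subst h; simp
    · simp [h]

/-- The action of `∏_J 𝓡` on a fixed element, as a linear map. -/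
def actLinear (m : M.obj S) : (J → S) →ₗ[S] M.obj S where
  toFun a := s.act a m
  map_add' a b := s.ext_coord fun j => by simp only [coord_act, _root_.map_add, Pi.add_apply, add_mul]
  map_smul' c a := s.ext_coord fun j => by
    simp only [coord_act, _root_.map_smul, Pi.smul_apply, smul_eq_mul, RingHom.id_apply, mul_assoc]

theorem act_one (m : M.obj S) : s.act 1 m = m :=
  s.ext_coord fun j => by simp only [coord_act, Pi.one_apply, one_mul]

end

/-- A functional on a sandwiched functor is given by its values on `⊕_J 𝓡`. -/
theorem exists_finset_apply_eq_sum {S : Type u} [CommRing S] [Algebra R S]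
    (w : RestrictedHom M (structureFunctor R) S) (T : Type u) [CommRing T] [Algebra R T]
    (φ : S →ₐ[R] T) (m : M.obj T) :
    ∃ t : Finset J, (∀ j ∉ t, s.coord T j m * w.app T φ (s.basis T j) = (0 : T)) ∧
      w.app T φ m = (∑ j ∈ t, s.coord T j m * w.app T φ (s.basis T j) : T) := by
  classical
  -- The functional `b ↦ w(b • m)` on `∏_J 𝓡`; evaluating it at `b = 1` below recovers `w(m)`.
  let w' : RestrictedHom (prod R J) (structureFunctor R) T :=
    { app := fun U _ _ ψ => (w.app U (ψ.comp φ)).comp (s.actLinear (M.map ψ m))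
      naturality := fun {U V _ _ _ _} ψ g b => by
        have h := w.naturality (ψ.comp φ) g (s.act b (M.map ψ m))
        rw [s.map_act, ← M.map_comp] at h
        exact h }
  obtain ⟨t, ht⟩ := w'.exists_finset_apply_eq_sum
  obtain ⟨h1, h2⟩ := ht T (AlgHom.id R T)
  have h3 : ∀ b : J → T, w'.app T (AlgHom.id R T) b = w.app T φ (s.act b m) := fun b => by
    change w.app T φ (s.act b (M.map (AlgHom.id R T) m)) = _
    rw [M.map_id]
  have h4 : ∀ j, w'.app T (AlgHom.id R T) (Pi.single j 1 : J → T) =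
      (s.coord T j m * w.app T φ (s.basis T j) : T) := fun j => by
    rw [h3, s.act_single]
    exact (w.app T φ).map_smul _ _
  refine ⟨t, fun j hj => (h4 j).symm.trans (h1 j hj), ?_⟩
  have h5 := h2 1
  rw [h3, s.act_one] at h5
  refine h5.trans (Finset.sum_congr rfl fun j _ => ?_)
  rw [h4]
  exact one_mul _

end Sandwich

/-! ### Infinite sums in a dual functor. -/

/-- In a dual functor, a family that is pointwise finitely supported extends to a morphism
from the product. -/
theorem exists_restrictedHom_prod_of_finite_support {M : FunctorOfModules.{u, w} R}
    {N : FunctorOfModules.{u, v} R} (e : Hom M (dual N))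
    (he : ∀ (S : Type u) [CommRing S] [Algebra R S], Function.Bijective (e.app S))
    {T : Type u} [CommRing T] [Algebra R T] {K : Type u} [DecidableEq K] (x : K → M.obj T)
    (hx : ∀ (U : Type u) [CommRing U] [Algebra R U] (ψ : T →ₐ[R] U) (n : N.obj U),
      (Function.support fun k => ((e.app T (x k)).app U ψ n : U)).Finite) :
    ∃ Ψ : RestrictedHom (prod R K) M T,
      ∀ k, Ψ.app T (AlgHom.id R T) (Pi.single k 1 : K → T) = x k := by
  let d : ∀ (U : Type u) [CommRing U] [Algebra R U] (ψ : T →ₐ[R] U) (n : N.obj U) (k : K), U :=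
    fun U _ _ ψ n k => (e.app T (x k)).app U ψ n
  have d_map : ∀ {U V : Type u} [CommRing U] [Algebra R U] [CommRing V] [Algebra R V]
      (ψ : T →ₐ[R] U) (g : U →ₐ[R] V) (n : N.obj U) (k : K),
      d V (g.comp ψ) (N.map g n) k = g (d U ψ n k) :=
    fun ψ g n k => (e.app T (x k)).naturality ψ g n
  have hfin : ∀ (U : Type u) [CommRing U] [Algebra R U] (ψ : T →ₐ[R] U) (n : N.obj U)
      (a : K → U), (Function.support fun k => a k * d U ψ n k).Finite := fun U _ _ ψ n a =>
    (hx U ψ n).subset (Function.support_mul_subset_right _ _)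
  -- The functional `∑ a_k x_k` on `N`, summed pointwise. A `finsum` with infinite support is `0`,
  -- so linearity and naturality rely on `hfin`.
  let D : ∀ (U : Type u) [CommRing U] [Algebra R U] (ψ : T →ₐ[R] U) (a : K → U),
      RestrictedHom N (structureFunctor R) U := fun U _ _ ψ a =>
    { app := fun V _ _ χ =>
        { toFun := fun n => (∑ᶠ k, χ (a k) * d V (χ.comp ψ) n k : V)
          map_add' := fun n n' => by
            rw [← finsum_add_distrib (hfin V _ n _) (hfin V _ n' _)]
            refine finsum_congr fun k => ?_
            rw [← mul_add]
            exact congrArg _ (_root_.map_add _ _ _)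
          map_smul' := fun c n => by
            rw [RingHom.id_apply, smul_eq_mul, mul_finsum' _ _ (hfin V _ n _)]
            refine finsum_congr fun k => ?_
            rw [mul_left_comm]
            exact congrArg _ (_root_.map_smul _ _ _) }
      naturality := fun {V W _ _ _ _} χ g n => by
        change (∑ᶠ k, g (χ (a k)) * d W ((g.comp χ).comp ψ) (N.map g n) k : W) =
          g (∑ᶠ k, χ (a k) * d V (χ.comp ψ) n k)
        refine Eq.trans ?_ ((g : V →+ W).map_finsum (hfin V (χ.comp ψ) n fun k => χ (a k))).symm
        refine finsum_congr fun k => ?_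
        refine Eq.trans ?_ (map_mul g _ _).symm
        rw [← d_map, AlgHom.comp_assoc] }
  have D_app : ∀ (U : Type u) [CommRing U] [Algebra R U] (ψ : T →ₐ[R] U) (a : K → U)
      (V : Type u) [CommRing V] [Algebra R V] (χ : U →ₐ[R] V) (n : N.obj V),
      (D U ψ a).app V χ n = (∑ᶠ k, χ (a k) * d V (χ.comp ψ) n k : V) :=
    fun _ _ _ _ _ _ _ _ _ _ => rfl
  -- Preimages under `e`. As `e` is injective, linearity and naturality of `y` can be checked on the
  -- functionals `D`.
  choose y hy using fun (U : Type u) (_ : CommRing U) (_ : Algebra R U) (ψ : T →ₐ[R] U)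
    (a : K → U) => (he U).2 (D U ψ a)
  refine ⟨
    { app := fun U _ _ ψ =>
        { toFun := fun a => y U _ _ ψ a
          map_add' := fun a b => (he U).1 ?_
          map_smul' := fun c a => (he U).1 ?_ }
      naturality := fun {U V _ _ _ _} ψ g a => (he V).1 ?_ }, fun k => (he T).1 ?_⟩
  · rw [_root_.map_add, hy, hy, hy]
    refine RestrictedHom.ext' fun V _ _ χ => LinearMap.ext fun n => ?_
    rw [RestrictedHom.add_app, LinearMap.add_apply, D_app, D_app, D_app]
    refine Eq.trans (finsum_congr fun k => ?_)
      (finsum_add_distrib (hfin V _ n fun k => χ (a k)) (hfin V _ n fun k => χ (b k)))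
    rw [← add_mul, ← _root_.map_add]; rfl
  · rw [_root_.map_smul, hy, hy]
    refine RestrictedHom.ext' fun V _ _ χ => LinearMap.ext fun n => ?_
    rw [RingHom.id_apply, RestrictedHom.smul_app, LinearMap.smul_apply, D_app, D_app]
    refine Eq.trans (finsum_congr fun k => ?_)
      (mul_finsum' _ (χ c) (hfin V _ n fun k => χ (a k))).symm
    rw [← mul_assoc, ← map_mul]; rfl
  · refine (hy V _ _ _ _).trans (Eq.trans ?_ (e.naturality g (y U _ _ ψ a)).symm)
    rw [hy]
    exact RestrictedHom.ext' fun W _ _ χ => LinearMap.ext fun n => rfl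
  · refine (hy T _ _ _ _).trans ?_
    refine RestrictedHom.ext' fun V _ _ χ => LinearMap.ext fun n => ?_
    rw [D_app, finsum_eq_single _ k fun l hl => ?_]
    · simp only [Pi.single_eq_same, _root_.map_one, one_mul]; rfl
    · simp [Pi.single_eq_of_ne hl]

/-! ### Finiteness, and the matrix of a morphism. -/

namespace Sandwich

variable {I J : Type u} {M' : FunctorOfModules.{u, v} R} {M : FunctorOfModules.{u, w} R}
  (s' : Sandwich I M') (s : Sandwich J M)

/-- A functorial bilinear functional built from `f : M' → M = N^*` only involves finitely many
pairs of indices. -/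
theorem finite_support_act_act [DecidableEq I] [DecidableEq J] {N : FunctorOfModules.{u, u} R}
    (e : Hom M (dual N)) {S : Type u} [CommRing S] [Algebra R S] (f : RestrictedHom M' M S)
    (T : Type u) [CommRing T] [Algebra R T] (φ : S →ₐ[R] T) (m : M'.obj T)
    (U : Type u) [CommRing U] [Algebra R U] (ψ : T →ₐ[R] U) (n : N.obj U) :
    (Function.support fun k : I × J =>
      ((e.app T (s.act (Pi.single k.2 1) (f.app T φ (s'.act (Pi.single k.1 1) m)))).app
        U ψ n : U)).Finite := by
  -- The family `(b, c) ↦ ⟨c • f(b • m), n⟩`, read as one natural function on `∏_{I ⊔ J} 𝓡` over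
  -- `U`-algebras.
  let β : ∀ (V : Type u) [CommRing V] [Algebra R V], (U →ₐ[R] V) → (I ⊕ J → V) → V :=
    fun V _ _ χ b => (e.app V (s.act (fun j => b (.inr j)) (f.app V ((χ.comp ψ).comp φ)
      (s'.act (fun i => b (.inl i)) (M'.map (χ.comp ψ) m))))).app V (AlgHom.id R V) (N.map χ n)
  obtain ⟨t, ht⟩ := exists_finset_forall_eq_of_natural β fun {V W _ _ _ _} χ g b => by
    have h := (e.app V (s.act (fun j => b (.inr j)) (f.app V ((χ.comp ψ).comp φ)
      (s'.act (fun i => b (.inl i)) (M'.map (χ.comp ψ) m))))).naturality (AlgHom.id R V) g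
        (N.map χ n)
    refine Eq.trans ?_ h
    rw [← N.map_comp]
    have h' := fun x => congrArg (fun z => z.app W (AlgHom.id R W) (N.map (g.comp χ) n))
      (e.naturality g x)
    refine Eq.trans ?_ (h' _)
    rw [s.map_act, ← f.naturality, s'.map_act, ← M'.map_comp]
    rfl
  have hβ : ∀ b : I ⊕ J → T, β U (AlgHom.id R U) (fun k => ψ (b k)) =
      (e.app T (s.act (fun j => b (.inr j)) (f.app T φ
        (s'.act (fun i => b (.inl i)) m)))).app U ψ n := fun b => by
    have h' := fun x => congrArg (fun z => z.app U (AlgHom.id R U) n) (e.naturality ψ x)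
    refine Eq.trans ?_ (h' _)
    rw [s.map_act, ← f.naturality, s'.map_act]
    change (e.app U _).app U _ (N.map (AlgHom.id R U) n) = _
    rw [N.map_id]
    rfl
  refine ((t.toLeft ×ˢ t.toRight).finite_toSet).subset fun k hk => ?_
  by_contra hkt
  refine hk ?_
  have h0 : ∀ b : I ⊕ J → T, ((fun i => b (.inl i)) = 0 ∨ (fun j => b (.inr j)) = 0) →
      β U (AlgHom.id R U) (fun k => ψ (b k)) = 0 := fun b hb => by
    rw [hβ]
    have : s.act (fun j => b (.inr j)) (f.app T φ (s'.act (fun i => b (.inl i)) m)) = 0 := by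
      rcases hb with hb | hb <;> rw [hb]
      · rw [show s'.act 0 m = 0 from (s'.actLinear m).map_zero, _root_.map_zero]
        exact s.ext_coord fun j => by rw [coord_act, _root_.map_zero, mul_zero]
      · exact (s.actLinear _).map_zero
    rw [this, _root_.map_zero]; rfl
  have h1 := hβ (Sum.elim (Pi.single k.1 1) (Pi.single k.2 1))
  refine h1.symm.trans ?_
  have hk' : Sum.inl k.1 ∉ t ∨ Sum.inr k.2 ∉ t := by
    by_contra! h
    exact hkt (by simpa using h)
  have h2 : ∀ b : I ⊕ J → T, ((fun i => b (.inl i)) = 0 ∨ (fun j => b (.inr j)) = 0) →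
      (∀ l ∈ t, (Sum.elim (Pi.single k.1 1) (Pi.single k.2 1) : I ⊕ J → T) l = b l) →
      β U (AlgHom.id R U)
        (fun l => ψ ((Sum.elim (Pi.single k.1 1) (Pi.single k.2 1) : I ⊕ J → T) l)) = 0 :=
    fun b hb hbt => by
      rw [← h0 b hb]
      exact ht U _ _ _ fun l hl => congrArg ψ (hbt l hl)
  rcases hk' with hk' | hk'
  -- An index outside `t` is invisible to `β`, so the corresponding unit vector may be replaced by
  -- `0`.
  · refine h2 (Sum.elim 0 (Pi.single k.2 1)) (.inl rfl) fun l hl => ?_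
    rcases l with i | j
    · have : i ≠ k.1 := by rintro rfl; exact hk' hl
      simp [Pi.single_eq_of_ne this]
    · rfl
  · refine h2 (Sum.elim (Pi.single k.1 1) 0) (.inr rfl) fun l hl => ?_
    rcases l with i | j
    · rfl
    · have : j ≠ k.2 := by rintro rfl; exact hk' hl
      simp [Pi.single_eq_of_ne this]

/-- The composite of `f : M' → M` with the `j`-th coordinate of `M`. -/
def coordComp {S : Type u} [CommRing S] [Algebra R S] (f : RestrictedHom M' M S) (j : J) :
    RestrictedHom M' (structureFunctor R) S where
  app T _ _ φ := (s.coord T j).comp (f.app T φ)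
  naturality φ g m := by
    change s.coord _ j (f.app _ _ _) = g (s.coord _ j _)
    rw [f.naturality, coord_map]

/-- The matrix of a morphism of sandwiched functors. -/
noncomputable def entry (S : Type u) [CommRing S] [Algebra R S] :
    RestrictedHom M' M S →ₗ[S] (I × J → S) where
  toFun f k := s.coord S k.2 (f.app S (AlgHom.id R S) (s'.basis S k.1))
  map_add' f g := by
    funext k
    simp [RestrictedHom.add_app]
  map_smul' c f := by
    funext k
    simp [RestrictedHom.smul_app]

theorem map_entry {S : Type u} [CommRing S] [Algebra R S] (f : RestrictedHom M' M S)
    (T : Type u) [CommRing T] [Algebra R T] (φ : S →ₐ[R] T) (i : I) (j : J) :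
    s.coord T j (f.app T φ (s'.basis T i)) = φ (entry s' s S f (i, j)) := by
  have := f.naturality (AlgHom.id R S) φ (s'.basis S i)
  rw [map_basis] at this
  change s.coord T j (f.app T (φ.comp (AlgHom.id R S)) _) = φ (s.coord S j _)
  rw [this, coord_map]

theorem finite_support_mul_entry {S : Type u} [CommRing S] [Algebra R S]
    (f : RestrictedHom M' M S) (T : Type u) [CommRing T] [Algebra R T] (φ : S →ₐ[R] T)
    (m : M'.obj T) (j : J) :
    (Function.support fun i => s'.coord T i m * φ (entry s' s S f (i, j))).Finite := by
  obtain ⟨t, h, -⟩ := s'.exists_finset_apply_eq_sum (s.coordComp f j) T φ m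
  refine t.finite_toSet.subset fun i hi => ?_
  by_contra hit
  refine hi (Eq.trans ?_ (h i hit))
  exact congrArg _ (map_entry s' s f T φ i j).symm

/-- The `j`-th coordinate of `f` is a functional on `M'`, hence is determined by its values on the
`e_i`, which are the entries of the matrix. Injectivity of `entry` follows. -/
theorem coord_apply {S : Type u} [CommRing S] [Algebra R S]
    (f : RestrictedHom M' M S) (T : Type u) [CommRing T] [Algebra R T] (φ : S →ₐ[R] T)
    (m : M'.obj T) (j : J) :
    s.coord T j (f.app T φ m) = ∑ᶠ i, s'.coord T i m * φ (entry s' s S f (i, j)) := by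
  obtain ⟨t, h, h'⟩ := s'.exists_finset_apply_eq_sum (s.coordComp f j) T φ m
  have key : ∀ i, s'.coord T i m * (s.coordComp f j).app T φ (s'.basis T i) =
      s'.coord T i m * φ (entry s' s S f (i, j)) := fun i =>
    congrArg _ (map_entry s' s f T φ i j)
  rw [finsum_eq_sum_of_support_subset (s := t)]
  · exact h'.trans (Finset.sum_congr rfl fun i _ => key i)
  · intro i hi
    by_contra hit
    exact hi ((key i).symm.trans (h i hit))

theorem entry_injective (S : Type u) [CommRing S] [Algebra R S] :
    Function.Injective (entry s' s S) := fun f g h =>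
  RestrictedHom.ext' fun T _ _ φ => LinearMap.ext fun m => s.ext_coord fun j => by
    rw [coord_apply s' s, coord_apply s' s, h]

/-! ### Entrywise multiplication of matrices. -/

/-- Multiplying the matrix of a morphism to a dual functor by any matrix yields the matrix of a
morphism, pointwise. -/
theorem exists_coord_eq_finsum (hM : IsDualFunctor M) {S : Type u} [CommRing S] [Algebra R S]
    (f : RestrictedHom M' M S) (T : Type u) [CommRing T] [Algebra R T] (φ : S →ₐ[R] T)
    (a : I × J → T) (m : M'.obj T) :
    ∃ y : M.obj T, ∀ j, s.coord T j y =
      ∑ᶠ i, a (i, j) * (s'.coord T i m * φ (entry s' s S f (i, j))) := by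
  classical
  obtain ⟨N, e, he⟩ := hM
  -- Here `x (i, j)` equals `m_i φ(f_ij) e_j`, the contribution of one matrix entry to `f(m)`.
  let x : I × J → M.obj T := fun k =>
    s.act (Pi.single k.2 1) (f.app T φ (s'.act (Pi.single k.1 1) m))
  obtain ⟨Ψ, hΨ⟩ := exists_restrictedHom_prod_of_finite_support e he x
    fun U _ _ ψ n => finite_support_act_act s' s e f T φ m U ψ n
  have hx : ∀ i j' j, s.coord T j (x (i, j')) =
      if j = j' then s'.coord T i m * φ (entry s' s S f (i, j)) else 0 := fun i j' j => by
    rw [coord_act, act_single, _root_.map_smul, _root_.map_smul, map_entry s', Pi.single_apply]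
    split_ifs <;> simp
  refine ⟨Ψ.app T (AlgHom.id R T) a, fun j => ?_⟩
  obtain ⟨t, ht⟩ := (s.coordComp Ψ j).exists_finset_apply_eq_sum
  obtain ⟨h1, h2⟩ := ht T (AlgHom.id R T)
  have h3 : ∀ k, (s.coordComp Ψ j).app T (AlgHom.id R T) (Pi.single k 1 : I × J → T) =
      s.coord T j (x k) := fun k => congrArg (s.coord T j) (hΨ k)
  refine (h2 a).trans ?_
  rw [finsum_eq_sum_of_support_subset (s := t.image Prod.fst)]
  · simp only [h3] at h1 ⊢
    refine Eq.trans ?_ (Finset.sum_map (t.image Prod.fst) ⟨_, Prod.mk_left_injective j⟩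
      fun k => a k * (s'.coord T k.1 m * φ (entry s' s S f (k.1, j))))
    -- Compare the sum over `t` with the sum over column `j`: pairs of `t` off the column have zero
    -- `j`-th coordinate, and pairs of the column outside `t` vanish by `h1`.
    refine Finset.sum_congr_of_eq_on_inter ?_ ?_ ?_
    · rintro ⟨i, j'⟩ hk hk'
      rw [hx, if_neg, mul_zero]
      rintro rfl
      exact hk' (Finset.mem_map.2 ⟨i, Finset.mem_image_of_mem Prod.fst hk, rfl⟩)
    · intro k hk hk'
      obtain ⟨i, -, rfl⟩ := Finset.mem_map.1 hk
      have h4 : s.coord T j (x (i, j)) = 0 := h1 _ hk'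
      rw [hx, if_pos rfl] at h4
      change a (i, j) * (s'.coord T i m * φ (entry s' s S f (i, j))) = 0
      rw [h4, mul_zero]
    · intro k hk hk'
      obtain ⟨i, -, rfl⟩ := Finset.mem_map.1 hk'
      change a (i, j) * s.coord T j (x (i, j)) = _
      rw [hx, if_pos rfl]
      rfl
  · intro i hi
    by_contra hit
    refine hi ?_
    have h4 := h1 (i, j) fun h => hit (Finset.mem_image_of_mem Prod.fst h)
    rw [h3, hx, if_pos rfl] at h4
    change _ * _ = _
    rw [h4, mul_zero]

/-- The values given by `exists_coord_eq_finsum` are unique, since coordinates separate points, so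
they assemble into a linear natural map. At `e_i` only the term `a_ij f_ij` survives. -/
theorem exists_entry_eq_mul (hM : IsDualFunctor M) {S : Type u} [CommRing S] [Algebra R S]
    (a : I × J → S) (f : RestrictedHom M' M S) :
    ∃ g : RestrictedHom M' M S, entry s' s S g = a * entry s' s S f := by
  classical
  choose y hy using fun (T : Type u) (_ : CommRing T) (_ : Algebra R T) (φ : S →ₐ[R] T)
    (m : M'.obj T) => exists_coord_eq_finsum s' s hM f T φ (fun k => φ (a k)) m
  have hfin : ∀ (T : Type u) [CommRing T] [Algebra R T] (φ : S →ₐ[R] T) (m : M'.obj T) (j : J),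
      (Function.support fun i =>
        φ (a (i, j)) * (s'.coord T i m * φ (entry s' s S f (i, j)))).Finite :=
    fun T _ _ φ m j => (finite_support_mul_entry s' s f T φ m j).subset
      (Function.support_mul_subset_right _ _)
  refine ⟨
    { app := fun T _ _ φ =>
        { toFun := fun m => y T _ _ φ m
          map_add' := fun m n => s.ext_coord fun j => ?_
          map_smul' := fun c m => s.ext_coord fun j => ?_ }
      naturality := fun {T U _ _ _ _} φ g m => s.ext_coord fun j => ?_ }, ?_⟩
  · rw [_root_.map_add, hy, hy, hy, ← finsum_add_distrib (hfin T φ m j) (hfin T φ n j)]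
    exact finsum_congr fun i => by rw [_root_.map_add, add_mul, mul_add]
  · rw [RingHom.id_apply, _root_.map_smul, hy, hy, smul_eq_mul, mul_finsum' _ _ (hfin T φ m j)]
    exact finsum_congr fun i => by
      rw [_root_.map_smul, smul_eq_mul, mul_assoc, mul_left_comm]
  · refine (hy U _ _ _ _ j).trans ?_
    rw [coord_map]
    change _ = g (s.coord T j (y T _ _ φ m))
    rw [hy]
    refine Eq.trans ?_ ((g : T →+ U).map_finsum (hfin T φ m j)).symm
    refine finsum_congr fun i => ?_
    rw [coord_map]
    simp
  · funext k
    obtain ⟨i, j⟩ := k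
    refine (hy S _ _ (AlgHom.id R S) (s'.basis S i) j).trans ?_
    rw [finsum_eq_single _ i fun l hl => ?_]
    · simp [coord_basis]
    · simp [coord_basis, hl.symm]

end Sandwich

/-! ### The sandwich structure on the internal Hom. -/

namespace Sandwich

variable {I J : Type u} {M' : FunctorOfModules.{u, v} R} {M : FunctorOfModules.{u, w} R}
  (s' : Sandwich I M') (s : Sandwich J M)

/-- The morphism whose matrix has a single entry `1`, at `(i, j)`. -/
noncomputable def elementary (S : Type u) [CommRing S] [Algebra R S] (k : I × J) :
    RestrictedHom M' M S where
  app T _ _ _ := (s'.coord T k.1).smulRight (s.basis T k.2)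
  naturality φ g m := by
    simp only [LinearMap.smulRight_apply, coord_map, M.map_smul, map_basis]

theorem entry_linearCombination_elementary {S : Type u} [CommRing S] [Algebra R S]
    (b : I × J →₀ S) :
    entry s' s S (Finsupp.linearCombination S (elementary s' s S) b) = b := by
  classical
  refine DFunLike.congr_fun (f := (entry s' s S).comp (Finsupp.linearCombination S _))
    (g := Finsupp.lcoeFun) (Finsupp.lhom_ext' fun k => LinearMap.ext_ring ?_) b
  funext l
  simp only [LinearMap.comp_apply, Finsupp.lsingle_apply, Finsupp.linearCombination_single,
    one_smul, Finsupp.lcoeFun_apply]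
  change s.coord S l.2 (s'.coord S k.1 (s'.basis S l.1) • s.basis S k.2) = _
  rw [_root_.map_smul, coord_basis, coord_basis, Finsupp.single_apply]
  by_cases h1 : k.1 = l.1 <;> by_cases h2 : k.2 = l.2 <;> simp [Prod.ext_iff, eq_comm (a := l.1), h1, h2]

theorem entry_map {S T : Type u} [CommRing S] [Algebra R S] [CommRing T] [Algebra R T]
    (f : S →ₐ[R] T) (h : RestrictedHom M' M S) :
    entry s' s T ((internalHom M' M).map f h) = fun k => f (entry s' s S h k) :=
  funext fun k => map_entry s' s h T f k.1 k.2

/-- The morphisms into a dual functor form a functor of modules over the product. -/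
@[reducible]
noncomputable def internalHomModule (hM : IsDualFunctor M) (S : Type u) [CommRing S]
    [Algebra R S] : Module (I × J → S) (RestrictedHom M' M S) :=
  letI : SMul (I × J → S) (RestrictedHom M' M S) :=
    ⟨fun a f => (exists_entry_eq_mul s' s hM a f).choose⟩
  -- The chosen product is the only morphism with its matrix, so the module axioms pull back along
  -- `entry`.
  Function.Injective.module (I × J → S) (entry s' s S).toAddMonoidHom (entry_injective s' s S)
    fun a f => (exists_entry_eq_mul s' s hM a f).choose_spec

theorem entry_smul (hM : IsDualFunctor M) {S : Type u} [CommRing S] [Algebra R S]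
    (a : I × J → S) (f : RestrictedHom M' M S) :
    letI := internalHomModule s' s hM S
    entry s' s S (a • f) = a * entry s' s S f :=
  (exists_entry_eq_mul s' s hM a f).choose_spec

/-- The sandwich of `𝐇𝐨𝐦(M', M)` over `I × J`, with matrices as coordinates. -/
noncomputable def internalHom (hM : IsDualFunctor M) :
    Sandwich (I × J) (internalHom M' M) where
  module S _ _ := internalHomModule s' s hM S
  map_smul f a m := entry_injective s' s _ <| by
    rw [entry_map, entry_smul, entry_smul, entry_map]
    funext k
    exact map_mul f _ _
  diagonal_smul c m := entry_injective s' s _ <| by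
    rw [entry_smul, _root_.map_smul]
    rfl
  incl :=
    { app := fun S _ _ => Finsupp.linearCombination S (elementary s' s S)
      naturality := fun f b => entry_injective s' s _ <| by
        rw [entry_map, entry_linearCombination_elementary, entry_linearCombination_elementary]
        rfl }
  toProd :=
    { app := fun S _ _ => entry s' s S
      naturality := fun f m => entry_map s' s f m }
  incl_injective S _ _ b b' h := by
    have h' := congrArg (entry s' s S) h
    rw [entry_linearCombination_elementary, entry_linearCombination_elementary] at h'
    exact DFunLike.coe_injective h'
  toProd_injective S _ _ := entry_injective s' s S
  incl_smul S _ _ a b := entry_injective s' s S <| by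
    rw [entry_smul, entry_linearCombination_elementary, entry_linearCombination_elementary]
    rfl
  toProd_smul S _ _ a m := entry_smul s' s hM a m
  toProd_incl S _ _ b := entry_linearCombination_elementary s' s b

/-- A copy in the lowest universe of a sandwiched functor: its image in the product. -/
def image (s : Sandwich J M) :
    FunctorOfModules.{u, u} R where
  obj S _ _ := LinearMap.range (s.toProd.app S)
  addCommGroup _ _ _ := inferInstance
  module _ _ _ := inferInstance
  map f x := ⟨fun j => f (x.1 j), by
    obtain ⟨_, m, rfl⟩ := x
    exact ⟨M.map f m, s.toProd.naturality f m⟩⟩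
  map_id _ _ _ _ := rfl
  map_comp _ _ _ := rfl
  map_add f _ _ := Subtype.ext (funext fun _ => _root_.map_add f _ _)
  map_smul f _ _ := Subtype.ext (funext fun _ => map_mul f _ _)

/-- A sandwiched functor is isomorphic to its image in the product. -/
noncomputable def imageEquiv (s : Sandwich J M) (S : Type u) [CommRing S] [Algebra R S] :
    M.obj S ≃ₗ[S] s.image.obj S :=
  LinearEquiv.ofInjective (s.toProd.app S) (s.toProd_injective S)

theorem imageEquiv_map (s : Sandwich J M) {S T : Type u} [CommRing S] [Algebra R S]
    [CommRing T] [Algebra R T] (f : S →ₐ[R] T) (m : M.obj S) :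
    s.imageEquiv T (M.map f m) = s.image.map f (s.imageEquiv S m) :=
  Subtype.ext (s.toProd.naturality f m)

theorem imageEquiv_symm_map (s : Sandwich J M) {S T : Type u} [CommRing S] [Algebra R S]
    [CommRing T] [Algebra R T] (f : S →ₐ[R] T) (p : s.image.obj S) :
    (s.imageEquiv T).symm (s.image.map f p) = M.map f ((s.imageEquiv S).symm p) := by
  rw [LinearEquiv.symm_apply_eq, imageEquiv_map, LinearEquiv.apply_symm_apply]

end Sandwich

/-! ### Duality of the internal Hom via the tensor product. -/

/-- The map of a functor of modules along `f`, as an `f`-semilinear map. -/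
def mapSemilinear (M : FunctorOfModules.{u, v} R) {S T : Type u} [CommRing S] [Algebra R S]
    [CommRing T] [Algebra R T] (f : S →ₐ[R] T) : M.obj S →ₛₗ[(f : S →+* T)] M.obj T where
  toFun := M.map f
  map_add' := M.map_add f
  map_smul' := M.map_smul f

open TensorProduct in
/-- The tensor product of functors of modules, `S ↦ P(S) ⊗ N(S)`. -/
noncomputable def tensor (P : FunctorOfModules.{u, v} R) (N : FunctorOfModules.{u, w} R) :
    FunctorOfModules.{u, max v w} R where
  obj S _ _ := P.obj S ⊗[S] N.obj S
  addCommGroup _ _ _ := inferInstance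
  module _ _ _ := inferInstance
  map f := TensorProduct.map (P.mapSemilinear f) (N.mapSemilinear f)
  map_id S _ _ m := by
    induction m with
    | zero => simp only [_root_.map_zero]
    | add x y hx hy => rw [_root_.map_add, hx, hy]
    | tmul p n => exact congrArg₂ (· ⊗ₜ[S] ·) (P.map_id S p) (N.map_id S n)
  map_comp {_ _ U _ _ _ _ _ _} g f m := by
    induction m with
    | zero => simp only [_root_.map_zero]
    | add x y hx hy => simp only [_root_.map_add, hx, hy]
    | tmul p n => exact congrArg₂ (· ⊗ₜ[U] ·) (P.map_comp g f p) (N.map_comp g f n)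
  map_add f := _root_.map_add _
  map_smul f := map_smulₛₗ _

open TensorProduct in
/-- `𝐇𝐨𝐦(M', N^*)` is the dual of `M' ⊗ N`. -/
theorem Sandwich.isDualFunctor_internalHom {I : Type u} {M' : FunctorOfModules.{u, v} R}
    {M : FunctorOfModules.{u, w} R} (s' : Sandwich I M') (hM : IsDualFunctor M) :
    IsDualFunctor (FunctorOfModules.internalHom M' M) := by
  obtain ⟨N, e, he⟩ := hM
  -- The pairing `(p, n) ↦ ⟨f(p), n⟩` over `T`, using `f(p)` only at the identity of `T`. By
  -- `ev_map`, its values over all `T`-algebras recover the whole functional.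
  let ev : ∀ {S : Type u} [CommRing S] [Algebra R S] (f : RestrictedHom M' M S) (T : Type u)
      [CommRing T] [Algebra R T] (φ : S →ₐ[R] T), s'.image.obj T →ₗ[T] N.obj T →ₗ[T] T :=
    fun f T _ _ φ =>
      { toFun := fun p => (e.app T (f.app T φ ((s'.imageEquiv T).symm p))).app T (AlgHom.id R T)
        map_add' := fun p q => by simp only [_root_.map_add, RestrictedHom.add_app]
        map_smul' := fun c p => by
          simp only [_root_.map_smul, RestrictedHom.smul_app]
          rfl }
  have ev_map : ∀ {S T U : Type u} [CommRing S] [Algebra R S] [CommRing T] [Algebra R T]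
      [CommRing U] [Algebra R U] (f : RestrictedHom M' M S) (φ : S →ₐ[R] T) (g : T →ₐ[R] U)
      (p : s'.image.obj T) (n : N.obj U), ev f U (g.comp φ) (s'.image.map g p) n =
        (e.app T (f.app T φ ((s'.imageEquiv T).symm p))).app U g n := by
    intro S T U _ _ _ _ _ _ f φ g p n
    change (e.app U (f.app U (g.comp φ) ((s'.imageEquiv U).symm _))).app U _ n = _
    rw [s'.imageEquiv_symm_map, f.naturality, e.naturality]
    rfl
  let E : Hom (FunctorOfModules.internalHom M' M) (dual (tensor s'.image N)) :=
    { app := fun S _ _ =>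
        { toFun := fun f =>
            { app := fun T _ _ φ => TensorProduct.lift (ev f T φ)
              naturality := fun {T U _ _ _ _} φ g m => by
                refine TensorProduct.induction_on (motive := fun m => TensorProduct.lift
                  (ev f U (g.comp φ)) ((tensor s'.image N).map g m) =
                    g (TensorProduct.lift (ev f T φ) m)) m ?_ (fun p n => ?_) fun x y hx hy => ?_
                · exact (congrArg _ ((tensor s'.image N).map_zero g)).trans
                    ((_root_.map_zero _).trans (_root_.map_zero g).symm)
                · change ev f U (g.comp φ) (s'.image.map g p) (N.map g n) = g (ev f T φ p n)
                  rw [ev_map]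
                  exact (e.app T (f.app T φ ((s'.imageEquiv T).symm p))).naturality
                    (AlgHom.id R T) g n
                · refine (congrArg _ ((tensor s'.image N).map_add g x y)).trans
                    ((_root_.map_add _ _ _).trans ?_)
                  rw [hx, hy, _root_.map_add, _root_.map_add] }
          map_add' := fun f g => RestrictedHom.ext' fun T _ _ φ =>
            TensorProduct.ext' fun p n => by
              change (e.app T (f.app T φ _ + g.app T φ _)).app T _ n = _
              rw [_root_.map_add]; rfl
          map_smul' := fun c f => RestrictedHom.ext' fun T _ _ φ =>
            TensorProduct.ext' fun p n => by
              change (e.app T (φ c • f.app T φ _)).app T _ n = _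
              rw [_root_.map_smul]; rfl }
      naturality := fun _ _ => rfl }
  -- The image replaces `M'` only for size: a predual must take values in `Type u`.
  refine ⟨tensor s'.image N, E, fun S _ _ => ⟨fun f g hfg => ?_, fun h => ?_⟩⟩
  · have h1 : ∀ (T : Type u) [CommRing T] [Algebra R T] (φ : S →ₐ[R] T) (p : s'.image.obj T)
        (n : N.obj T), ev f T φ p n = ev g T φ p n := fun T _ _ φ p n =>
      congrArg (fun z : RestrictedHom (tensor s'.image N) (structureFunctor R) S =>
        z.app T φ (p ⊗ₜ[T] n)) hfg
    refine RestrictedHom.ext' fun T _ _ φ => LinearMap.ext fun m => (he T).1 ?_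
    refine RestrictedHom.ext' fun U _ _ ψ => LinearMap.ext fun n => ?_
    have h2 := h1 U (ψ.comp φ) (s'.image.map ψ (s'.imageEquiv T m)) n
    rw [ev_map, ev_map, LinearEquiv.symm_apply_apply] at h2
    exact h2
  -- Surjectivity: currying `h` sends `m` to the functional `n ↦ h(m ⊗ n)` on `N`, with `m`
  -- transported to each `T`-algebra; the inverse of `e` turns it into a point of `M`.
  · let D : ∀ (T : Type u) [CommRing T] [Algebra R T] (φ : S →ₐ[R] T),
        M'.obj T →ₗ[T] RestrictedHom N (structureFunctor R) T := fun T _ _ φ =>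
      { toFun := fun m =>
          { app := fun U _ _ ψ => (h.app U (ψ.comp φ)).comp
              (TensorProduct.mk U (s'.image.obj U) (N.obj U)
                (s'.image.map ψ (s'.imageEquiv T m)))
            naturality := fun {U V _ _ _ _} ψ g n => by
              have h1 := h.naturality (ψ.comp φ) g
                (s'.image.map ψ (s'.imageEquiv T m) ⊗ₜ[U] n)
              refine Eq.trans ?_ h1
              change h.app V _ (s'.image.map (g.comp ψ) (s'.imageEquiv T m) ⊗ₜ[V] N.map g n) =
                h.app V _ (s'.image.map g (s'.image.map ψ (s'.imageEquiv T m)) ⊗ₜ[V] N.map g n)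
              rw [s'.image.map_comp]
              rfl }
        map_add' := fun m m' => RestrictedHom.ext' fun U _ _ ψ => by
          simp only [_root_.map_add, FunctorOfModules.map_add, RestrictedHom.add_app]
          exact LinearMap.comp_add _ _ _
        map_smul' := fun c m => RestrictedHom.ext' fun U _ _ ψ => by
          simp only [_root_.map_smul, FunctorOfModules.map_smul, RestrictedHom.smul_app,
            RingHom.id_apply]
          exact LinearMap.comp_smul _ _ _ }
    let eq : ∀ (T : Type u) [CommRing T] [Algebra R T],
        M.obj T ≃ₗ[T] RestrictedHom N (structureFunctor R) T :=
      fun T _ _ => LinearEquiv.ofBijective (e.app T) (he T)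
    have e_eq : ∀ (T : Type u) [CommRing T] [Algebra R T]
        (d : RestrictedHom N (structureFunctor R) T), e.app T ((eq T).symm d) = d :=
      fun T _ _ d => (eq T).apply_symm_apply d
    refine ⟨
      { app := fun T _ _ φ => (eq T).symm.toLinearMap.comp (D T φ)
        naturality := fun {T U _ _ _ _} φ g m => (he U).1 ?_ }, ?_⟩
    · refine (e_eq U _).trans (Eq.trans ?_ (e.naturality g _).symm)
      refine Eq.trans ?_ (congrArg ((dual N).map g) (e_eq T (D T φ m)).symm)
      refine RestrictedHom.ext' fun V _ _ ψ => LinearMap.ext fun n => ?_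
      change h.app V _ (s'.image.map ψ (s'.imageEquiv U (M'.map g m)) ⊗ₜ[V] n) =
        h.app V _ (s'.image.map (ψ.comp g) (s'.imageEquiv T m) ⊗ₜ[V] n)
      rw [s'.imageEquiv_map, s'.image.map_comp]
      rfl
    · refine RestrictedHom.ext' fun T _ _ φ => TensorProduct.ext' fun p n => ?_
      change (e.app T ((eq T).symm (D T φ ((s'.imageEquiv T).symm p)))).app T
        (AlgHom.id R T) n = _
      rw [e_eq]
      change h.app T ((AlgHom.id R T).comp φ) (s'.image.map (AlgHom.id R T)
        (s'.imageEquiv T ((s'.imageEquiv T).symm p)) ⊗ₜ[T] n) = _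
      rw [s'.image.map_id, LinearEquiv.apply_symm_apply]
      rfl

end FunctorOfModules

theorem theoremF8p7 {R : Type u} [CommRing R]
    (M' : FunctorOfModules.{u, v} R) (M : FunctorOfModules.{u, w} R)
    (hM' : M'.MemF) (hM : M.MemF) :
    (FunctorOfModules.internalHom M' M).MemF ∧
      ∀ I J : Type u, Nonempty (FunctorOfModules.Sandwich I M') →
        Nonempty (FunctorOfModules.Sandwich J M) →
        Nonempty (FunctorOfModules.Sandwich (I × J) (FunctorOfModules.internalHom M' M)) := by
  obtain ⟨-, I, ⟨s'⟩⟩ := hM'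
  obtain ⟨hdual, J, ⟨s⟩⟩ := hM
  exact ⟨⟨s'.isDualFunctor_internalHom hdual, I × J, ⟨s'.internalHom s hdual⟩⟩,
    fun I J ⟨t'⟩ ⟨t⟩ => ⟨t'.internalHom t hdual⟩⟩
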